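/- Let $d\ge 3$ and $1\le a<b\le d-1$ be integers with $\gcd(a,b,d)=1$. Let $\mathrm{Circ}_{(d;0,a,b)}$ be the $d\times d$ circulant matrix over $\mathbb{Z}[x,y,z]$ whose entry in row $i$ and column $j$ ($0\le i,j\le d-1$) is $x$ if $j-i\equiv 0$, $y$ if $j-i\equiv a$, $z$ if $j-i\equiv b \pmod d$, and $0$ otherwise. For nonnegative integers $A,B$ with $A+B\le d$, let $c_{A,B}$ be the coefficient of $x^{d-A-B}y^Az^B$ in $\det \mathrm{Circ}_{(d;0,a,b)}$. Then: (1) $c_{A,B}\ne 0$ if and only if $d\mid aA+bB$. Assume moreover that $d\mid aA+bB$, and put $k=\gcd\left(A,B,\frac{aA+bB}{d}\right)$ (so $k=0$ exactly when $A=B=0$). Then: (2) $c_{A,B}>0$ if and only if at least one of the integers $k$ and $A+B-1$ is even. (3) $|c_{A,B}|$ equals the number of permutations of $\{0,\dots,d-1\}$ whose decomposition into disjoint nontrivial cycles consists of exactly $k$ cycles $C_1,\dots,C_k$, where each $C_i$ has length $(A+B)/k$ and has exactly $A/k$ elements $j$ with $C_i(j)\equiv j+a$ and exactly $B/k$ elements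 $j$ with $C_i(j)\equiv j+b\pmod d$. (If $k=0$, the only such permutation is the identity.) -/

import Mathlib

/-- The circulant matrix with first row `x`: the entry in position `(i, j)` is `x_{j-i}`, the
index being taken modulo `d` (subtraction in `Fin d` is modulo `d`). -/
def circ {d : ℕ} {R : Type*} (x : Fin d → R) : Matrix (Fin d) (Fin d) R :=
  Matrix.of fun i j => x (j - i)

/-- The three-lines circulant matrix `Circ_(d;0,a,b)` over `ℤ[x, y, z]`, where `x`, `y`, `z` are
`X 0`, `X 1`, `X 2`: its first row has `x` in position `0`, `y` in position `a`, `z` in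
position `b` (counting from zero), and zeros elsewhere. -/
noncomputable def circThree (d a b : ℕ) :
    Matrix (Fin d) (Fin d) (MvPolynomial (Fin 3) ℤ) :=
  circ fun i =>
    if (i : ℕ) = 0 then MvPolynomial.X 0
    else if (i : ℕ) = a then MvPolynomial.X 1
    else if (i : ℕ) = b then MvPolynomial.X 2
    else 0

/-- The coefficient of `x^(d-A-B) y^A z^B` in `det Circ_(d;0,a,b)`. -/
noncomputable def detCoeff (d a b A B : ℕ) : ℤ :=
  MvPolynomial.coeff
    (Finsupp.single 0 (d - A - B) + Finsupp.single 1 A + Finsupp.single 2 B)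
    (circThree d a b).det

/-- The set of those `i` in `{0, …, d-1}` with `σ(i) ≡ i + q` modulo `d`. -/
def stepSet {d : ℕ} (q : ℕ) (σ : Equiv.Perm (Fin d)) : Finset (Fin d) :=
  Finset.univ.filter fun i => (σ i : ℕ) ≡ (i : ℕ) + q [MOD d]

/-- The permutations in `S_d` whose decomposition into disjoint nontrivial cycles has exactly `k`
cycles, each of length `m`, and each having exactly `p` elements `j` of step `+a` and `q` elements
`j` of step `+b` modulo `d`. -/
def cyclePerms (d a b k m p q : ℕ) : Set (Equiv.Perm (Fin d)) :=
  {σ | σ.cycleFactorsFinset.card = k ∧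
    ∀ C ∈ σ.cycleFactorsFinset,
      C.support.card = m ∧ (stepSet a C).card = p ∧ (stepSet b C).card = q}

/-! A permutation contributes to the coefficient exactly when it has A steps +a, B steps +b and
fixes every other point. The point is that all these permutations have the same sign, so nothing
cancels.

Lift each orbit to a lattice path by counting its a-steps and b-steps. Two paths whose starting
points differ by a multiple of a - b cannot cross: at a meeting two distinct points would have the
same image (`TwoStep.noncrossing`). Comparing a closed path with its own translates shows that the
class (p, q, w) of a cycle, where ap + bq = dw, is primitive (`IsThreeStep.gcd_eq_one`). Comparing
two cycles over many turns shows that their slopes agree, so their classes coincide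
(`IsThreeStep.cycles_eq`). With n cycles the total class is n(p, q, w), hence n = k, and the common
sign is (-1)^(A+B+k).

The coefficient is therefore nonzero once one such permutation exists. `exists_isThreeStep` builds
one by exchanging two adjacent intervals, pulled back along a multiplication on `ZMod d`. -/

/-! ### Noncrossing of lifted orbits. -/

section Noncrossing

variable {X G : Type*} [AddCommGroup G]

/-- The number of marked points among the first `n` points of the orbit of `i`. -/
def markCount (σ : Equiv.Perm X) (e : X → ℤ) (n : ℕ) (i : X) : ℤ :=
  ∑ j ∈ Finset.range n, e ((σ ^ j) i)

/-- On the invariant set `M`, the permutation `σ` moves each point, in the coordinate `c`, by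
`v` or by `v + D`, the latter at the points marked by `e`. -/
structure TwoStep (σ : Equiv.Perm X) (c : X → G) (e : X → ℤ) (M : Set X) (v D : G) : Prop where
  inj : Function.Injective c
  mark : ∀ i, e i = 0 ∨ e i = 1
  maps : ∀ i ∈ M, σ i ∈ M
  step : ∀ i ∈ M, c (σ i) = c i + v + e i • D

variable {σ : Equiv.Perm X} {c : X → G} {e : X → ℤ} {M : Set X} {v D : G}

theorem markCount_succ (σ : Equiv.Perm X) (e : X → ℤ) (n : ℕ) (i : X) :
    markCount σ e (n + 1) i = markCount σ e n i + e ((σ ^ n) i) :=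
  Finset.sum_range_succ _ _

theorem markCount_add (σ : Equiv.Perm X) (e : X → ℤ) (m n : ℕ) (i : X) :
    markCount σ e (m + n) i = markCount σ e m i + markCount σ e n ((σ ^ m) i) := by
  simp only [markCount, Finset.sum_range_add, ← Equiv.Perm.mul_apply, ← pow_add, add_comm]

theorem markCount_mul_of_period {L : ℕ} {i : X} (h : (σ ^ L) i = i) (N : ℕ) :
    markCount σ e (N * L) i = N * markCount σ e L i := by
  induction N with
  | zero => simp [markCount]
  | succ N ih =>
    have hN : (σ ^ (N * L)) i = i := by
      rw [mul_comm, pow_mul]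
      exact Function.IsFixedPt.perm_pow h N
    rw [Nat.succ_mul, markCount_add, hN, ih]
    push_cast
    ring

theorem markCount_mul_eq_sum (σ : Equiv.Perm X) (e : X → ℤ) (n r : ℕ) (i : X) :
    markCount σ e (r * n) i =
      ∑ j ∈ Finset.range r, markCount σ e n ((σ ^ (j * n)) i) := by
  induction r with
  | zero => simp [markCount]
  | succ r ih => rw [Nat.succ_mul, markCount_add, ih, Finset.sum_range_succ]

namespace TwoStep

theorem pow_mem (h : TwoStep σ c e M v D) {i : X} (hi : i ∈ M) (n : ℕ) : (σ ^ n) i ∈ M := by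
  induction n with
  | zero => simpa using hi
  | succ n ih => rw [pow_succ', Equiv.Perm.mul_apply]; exact h.maps _ ih

theorem coord_pow (h : TwoStep σ c e M v D) {i : X} (hi : i ∈ M) (n : ℕ) :
    c ((σ ^ n) i) = c i + n • v + markCount σ e n i • D := by
  induction n with
  | zero => simp [markCount]
  | succ n ih =>
    rw [pow_succ', Equiv.Perm.mul_apply, h.step _ (h.pow_mem hi n), ih, markCount_succ,
      succ_nsmul, add_smul]
    abel

/-- Orbits, lifted to lattice paths in the plane, do not cross. -/
theorem noncrossing (h : TwoStep σ c e M v D) {i i' : X} (hi : i ∈ M) (hi' : i' ∈ M) {t : ℤ}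
    (ht : 0 < t) (hc : c i' = c i + t • D) (n : ℕ) :
    0 < t + markCount σ e n i' - markCount σ e n i := by
  induction n with
  | zero => simpa [markCount] using ht
  | succ n ih =>
    rw [markCount_succ, markCount_succ]
    have hm := h.mark ((σ ^ n) i)
    have hm' := h.mark ((σ ^ n) i')
    -- The integer gap changes by at most 1 per step, so it can only reach 0 from 1, with `i` marked
    -- and `i'` not. Two different points would then have the same image.
    by_contra hcon
    have h1 : e ((σ ^ n) i) = 1 := by omega
    have h0 : e ((σ ^ n) i') = 0 := by omega
    have ht1 : t + markCount σ e n i' - markCount σ e n i = 1 := by omega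
    have key : c (σ ((σ ^ n) i)) = c (σ ((σ ^ n) i')) := by
      rw [h.step _ (h.pow_mem hi n), h.step _ (h.pow_mem hi' n), h.coord_pow hi, h.coord_pow hi',
        h1, h0, hc]
      have : markCount σ e n i = t + markCount σ e n i' - 1 := by omega
      rw [this, sub_smul, add_smul]
      simp only [one_smul, zero_smul]
      abel
    have := σ.injective (h.inj key)
    rw [this, h0] at h1
    exact zero_ne_one h1

theorem noncrossing_neg (h : TwoStep σ c e M v D) {i i' : X} (hi : i ∈ M) (hi' : i' ∈ M) {t : ℤ}
    (ht : t < 0) (hc : c i' = c i + t • D) (n : ℕ) :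
    t + markCount σ e n i' - markCount σ e n i < 0 := by
  have := h.noncrossing hi' hi (t := -t) (by omega) (by rw [hc, neg_smul]; abel) n
  omega

/-- If `r` times the lattice vector `n v + p D = 0` closes up the orbit of `i`, then that vector
itself already does. -/
theorem pow_apply_eq_self (h : TwoStep σ c e M v D) {i : X} (hi : i ∈ M) {r n : ℕ} (hr : 0 < r)
    {p : ℤ} (hp : n • v + p • D = 0) (hL : markCount σ e (r * n) i = r * p) :
    (σ ^ n) i = i := by
  set s : ℕ → ℤ := fun j => markCount σ e n ((σ ^ (j * n)) i) - p with hs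
  -- Cut the orbit into blocks of length `n`; since n v = -p D, block `j` displaces the coordinate
  -- by `s j • D`.
  have hnext : ∀ j, c ((σ ^ ((j + 1) * n)) i) = c ((σ ^ (j * n)) i) + s j • D := by
    intro j
    rw [show (j + 1) * n = n + j * n by ring, pow_add, Equiv.Perm.mul_apply,
      h.coord_pow (h.pow_mem hi _), hs, sub_smul]
    rw [show n • v = -(p • D) from eq_neg_of_add_eq_zero_left hp]
    abel
  have hsum : ∑ j ∈ Finset.range r, s j = 0 := by
    simp only [hs, Finset.sum_sub_distrib, ← markCount_mul_eq_sum, hL]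
    simp
  have hsucc : ∀ j, s (j + 1) = s j + markCount σ e n ((σ ^ ((j + 1) * n)) i) -
      markCount σ e n ((σ ^ (j * n)) i) := by
    intro j; simp only [hs]; ring
  have hne : (Finset.range r).Nonempty := Finset.nonempty_range_iff.2 hr.ne'
  -- Noncrossing of two consecutive blocks carries the sign of `s j` to `s (j + 1)`. A nonzero `s 0`
  -- would make all terms of the vanishing sum have one sign.
  have h0 : s 0 = 0 := by
    rcases lt_trichotomy (s 0) 0 with h0 | h0 | h0
    · have : ∀ j, s j < 0 := by
        intro j
        induction j with
        | zero => exact h0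
        | succ j ih =>
          rw [hsucc]
          exact h.noncrossing_neg (h.pow_mem hi _) (h.pow_mem hi _) ih (hnext j) n
      exact absurd hsum (Finset.sum_neg (fun j _ => this j) hne).ne
    · exact h0
    · have : ∀ j, 0 < s j := by
        intro j
        induction j with
        | zero => exact h0
        | succ j ih =>
          rw [hsucc]
          exact h.noncrossing (h.pow_mem hi _) (h.pow_mem hi _) ih (hnext j) n
      exact absurd hsum (Finset.sum_pos (fun j _ => this j) hne).ne'
  have := hnext 0
  rw [h0, zero_smul, add_zero] at this
  simpa using h.inj this

/-- Two periodic orbits have the same slope. -/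
theorem slope_eq (h : TwoStep σ c e M v D) {i i' : X} (hi : i ∈ M) (hi' : i' ∈ M) {L L' : ℕ}
    (hL : (σ ^ L) i = i) (hL' : (σ ^ L') i' = i') {t : ℤ} {q : ℕ} (hq : 0 < q) (hD : q • D = 0)
    (hc : c i' = c i + t • D) :
    L' * markCount σ e L i = L * markCount σ e L' i' := by
  -- As D is torsion, `t` matters only modulo `q`. One positive and one negative representative
  -- confine the difference of mark counts for all time.
  have hshift : ∀ z : ℤ, c i' = c i + (t + z * q) • D := by
    intro z
    rw [add_smul, mul_smul, natCast_zsmul, hD, smul_zero, add_zero, hc]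
  have hup : ∀ N : ℕ, 0 < (t + (|t| + 1) * q) + markCount σ e N i' - markCount σ e N i := by
    intro N
    refine h.noncrossing hi hi' ?_ (hshift _) N
    have := neg_abs_le t
    have : (1 : ℤ) ≤ q := by exact_mod_cast hq
    nlinarith [abs_nonneg t]
  have hlow : ∀ N : ℕ, (t + (-(|t| + 1)) * q) + markCount σ e N i' - markCount σ e N i < 0 := by
    intro N
    refine h.noncrossing_neg hi hi' ?_ (hshift _) N
    have := le_abs_self t
    have : (1 : ℤ) ≤ q := by exact_mod_cast hq
    nlinarith [abs_nonneg t]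
  have hN : ∀ N : ℕ, markCount σ e (N * (L' * L)) i = N * (L' * markCount σ e L i) := by
    intro N
    rw [← mul_assoc, markCount_mul_of_period hL]
    push_cast; ring
  have hN' : ∀ N : ℕ, markCount σ e (N * (L' * L)) i' = N * (L * markCount σ e L' i') := by
    intro N
    rw [mul_comm L', ← mul_assoc, markCount_mul_of_period hL']
    push_cast; ring
  set x := L' * markCount σ e L i
  set y := L * markCount σ e L' i'
  set K := (|t| + 1) * q
  have hup' : ∀ N : ℕ, (N : ℤ) * (x - y) < t + K := by
    intro N; have := hup (N * (L' * L)); rw [hN, hN'] at this; linarith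
  have hlow' : ∀ N : ℕ, (N : ℤ) * (y - x) < K - t := by
    intro N; have := hlow (N * (L' * L)); rw [hN, hN'] at this; linarith
  rcases lt_trichotomy x y with hxy | hxy | hxy
  · exfalso
    -- The integer y - x is at least 1, so this many double periods already exceed the bound.
    have h2 := hlow' (K - t).toNat
    have h3 := Int.self_le_toNat (K - t)
    nlinarith
  · exact hxy
  · exfalso
    have h2 := hup' (t + K).toNat
    have h3 := Int.self_le_toNat (t + K)
    nlinarith

end TwoStep

end Noncrossing

/-! ### Cycles of three-step permutations and their lattice classes. -/

section Cycles

/-- The class of `i` in `ZMod d`. -/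
def coord {d : ℕ} (i : Fin d) : ZMod d := ((i : ℕ) : ZMod d)

theorem coord_injective {d : ℕ} : Function.Injective (coord (d := d)) := by
  intro i j h
  have := (ZMod.natCast_eq_natCast_iff _ _ _).1 h
  exact Fin.ext (Nat.ModEq.eq_of_lt_of_lt this i.2 j.2)

theorem mem_stepSet {d q : ℕ} {σ : Equiv.Perm (Fin d)} {i : Fin d} :
    i ∈ stepSet q σ ↔ coord (σ i) = coord i + q := by
  simp only [stepSet, Finset.mem_filter, Finset.mem_univ, true_and, coord]
  rw [← ZMod.natCast_eq_natCast_iff]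
  push_cast
  rfl

theorem natCast_ne_zero_of_lt {d q : ℕ} (h0 : 0 < q) (hq : q < d) : (q : ZMod d) ≠ 0 := by
  rw [Ne, ZMod.natCast_eq_zero_iff]
  exact Nat.not_dvd_of_pos_of_lt h0 hq

theorem stepSet_subset_support {d q : ℕ} (h0 : 0 < q) (hq : q < d) (σ : Equiv.Perm (Fin d)) :
    stepSet q σ ⊆ σ.support := by
  intro i hi
  rw [mem_stepSet] at hi
  rw [Equiv.Perm.mem_support]
  intro h
  rw [h] at hi
  exact natCast_ne_zero_of_lt h0 hq (by simpa using hi)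

theorem disjoint_stepSet {d a b : ℕ} (hab : a < b) (hb : b < d) (σ : Equiv.Perm (Fin d)) :
    Disjoint (stepSet a σ) (stepSet b σ) := by
  rw [Finset.disjoint_left]
  intro i hi hi'
  rw [mem_stepSet] at hi hi'
  rw [hi] at hi'
  have := (ZMod.natCast_eq_natCast_iff _ _ _).1 (add_left_cancel hi')
  exact hab.ne (Nat.ModEq.eq_of_lt_of_lt this (hab.trans hb) hb)

theorem stepSet_cycle {d q : ℕ} (h0 : 0 < q) (hq : q < d) {σ C : Equiv.Perm (Fin d)}
    (hC : C ∈ σ.cycleFactorsFinset) : stepSet q C = (stepSet q σ).filter (· ∈ C.support) := by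
  ext i
  rw [Finset.mem_filter]
  constructor
  · intro hi
    have hs := stepSet_subset_support h0 hq C hi
    refine ⟨?_, hs⟩
    rw [mem_stepSet] at hi ⊢
    rwa [← (Equiv.Perm.mem_cycleFactorsFinset_iff.1 hC).2 i hs]
  · rintro ⟨hi, hs⟩
    rw [mem_stepSet] at hi ⊢
    rwa [(Equiv.Perm.mem_cycleFactorsFinset_iff.1 hC).2 i hs]

/-- A set of non-fixed points is partitioned by the cycles. -/
theorem card_eq_sum_cycles {α : Type*} [Fintype α] [DecidableEq α] (σ : Equiv.Perm α)
    {S : Finset α} (hS : S ⊆ σ.support) :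
    S.card = ∑ C ∈ σ.cycleFactorsFinset, (S.filter (· ∈ C.support)).card := by
  rw [← Finset.card_biUnion]
  · congr 1
    ext i
    simp only [Finset.mem_biUnion, Finset.mem_filter]
    constructor
    · intro hi
      obtain ⟨C, hC, h⟩ :=
        Equiv.Perm.mem_support_iff_mem_support_of_mem_cycleFactorsFinset.1 (hS hi)
      exact ⟨C, hC, hi, h⟩
    · rintro ⟨C, -, hi, -⟩
      exact hi
  · intro C hC C' hC' hne
    have := (Equiv.Perm.cycleFactorsFinset_pairwise_disjoint σ hC hC' hne).disjoint_support
    rw [Finset.disjoint_left] at this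
    refine Finset.disjoint_left.2 fun i hi hi' => ?_
    exact this (Finset.mem_filter.1 hi).2 (Finset.mem_filter.1 hi').2

theorem card_stepSet_eq_sum {d q : ℕ} (h0 : 0 < q) (hq : q < d) (σ : Equiv.Perm (Fin d)) :
    (stepSet q σ).card = ∑ C ∈ σ.cycleFactorsFinset, (stepSet q C).card := by
  rw [card_eq_sum_cycles σ (stepSet_subset_support h0 hq σ)]
  exact Finset.sum_congr rfl fun C hC => by rw [stepSet_cycle h0 hq hC]

/-- Every point which is not fixed by `σ` moves by `a` or by `b`. -/
def IsThreeStep {d : ℕ} (a b : ℕ) (σ : Equiv.Perm (Fin d)) : Prop :=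
  σ.support = stepSet a σ ∪ stepSet b σ

theorem IsThreeStep.card_support {d a b : ℕ} {σ : Equiv.Perm (Fin d)} (h : IsThreeStep a b σ)
    (hab : a < b) (hb : b < d) :
    σ.support.card = (stepSet a σ).card + (stepSet b σ).card := by
  rw [h, Finset.card_union_of_disjoint (disjoint_stepSet hab hb σ)]

theorem IsThreeStep.cycle {d a b : ℕ} {σ C : Equiv.Perm (Fin d)} (h : IsThreeStep a b σ)
    (ha : 0 < a) (hab : a < b) (hb : b < d) (hC : C ∈ σ.cycleFactorsFinset) :
    IsThreeStep a b C := by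
  unfold IsThreeStep at *
  rw [stepSet_cycle ha (hab.trans hb) hC, stepSet_cycle (ha.trans hab) hb hC,
    ← Finset.filter_union, ← h]
  ext i
  rw [Finset.mem_filter]
  exact ⟨fun hi => ⟨Equiv.Perm.mem_cycleFactorsFinset_support_le hC hi, hi⟩, And.right⟩

theorem IsThreeStep.of_cycles {d a b : ℕ} {σ : Equiv.Perm (Fin d)}
    (ha : 0 < a) (hab : a < b) (hb : b < d)
    (h : ∀ C ∈ σ.cycleFactorsFinset, IsThreeStep a b C) : IsThreeStep a b σ := by
  refine Finset.Subset.antisymm (fun i hi => ?_) (Finset.union_subset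
    (stepSet_subset_support ha (hab.trans hb) σ) (stepSet_subset_support (ha.trans hab) hb σ))
  obtain ⟨C, hC, hiC⟩ := Equiv.Perm.mem_support_iff_mem_support_of_mem_cycleFactorsFinset.1 hi
  have := h C hC
  rw [IsThreeStep, stepSet_cycle ha (hab.trans hb) hC, stepSet_cycle (ha.trans hab) hb hC,
    ← Finset.filter_union] at this
  rw [this] at hiC
  exact (Finset.mem_filter.1 hiC).1

/-- The indicator of the points which move by `q`. -/
def stepMark {d : ℕ} (q : ℕ) (σ : Equiv.Perm (Fin d)) (i : Fin d) : ℤ :=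
  if i ∈ stepSet q σ then 1 else 0

/-- With b as base step and the a-steps marked, the extra displacement is a - b. Fixed points, which
move by neither, are excluded from the invariant set. -/
theorem IsThreeStep.twoStep {d a b : ℕ} {σ : Equiv.Perm (Fin d)} (h : IsThreeStep a b σ) :
    TwoStep σ coord (stepMark a σ) (σ.support : Set (Fin d)) (b : ZMod d) ((a : ZMod d) - b) where
  inj := coord_injective
  mark i := by unfold stepMark; split_ifs <;> simp
  maps i hi := by simpa using hi
  step i hi := by
    unfold stepMark
    split_ifs with hm
    · rw [mem_stepSet.1 hm, one_smul]; ring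
    · rw [Finset.mem_coe, h, Finset.mem_union] at hi
      rw [mem_stepSet.1 (hi.resolve_left hm), zero_smul, add_zero]

/-- One turn around the cycle visits each point of its support exactly once. -/
theorem markCount_cycle {d q : ℕ} (h0 : 0 < q) (hq : q < d) {σ C : Equiv.Perm (Fin d)}
    (hC : C ∈ σ.cycleFactorsFinset) {i : Fin d} (hi : i ∈ C.support) :
    markCount σ (stepMark q σ) C.support.card i = (stepSet q C).card := by
  have hcyc := Equiv.Perm.isCycleOn_support_of_mem_cycleFactorsFinset hC
  rw [stepSet_cycle h0 hq hC, Finset.filter_mem_eq_inter, Finset.inter_comm,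
    ← Finset.filter_mem_eq_inter, Finset.card_filter, markCount]
  push_cast
  refine Finset.sum_nbij (fun j => (σ ^ j) i) ?_ ?_ ?_ ?_
  · intro j _
    exact hcyc.1.mapsTo.perm_pow j hi
  · intro j hj j' hj' hjj
    have := (hcyc.pow_apply_eq_pow_apply hi).1 hjj
    exact Nat.ModEq.eq_of_lt_of_lt this (by simpa using hj) (by simpa using hj')
  · intro x hx
    obtain ⟨n, hn, hx⟩ := hcyc.exists_pow_eq hi hx
    exact ⟨n, by simpa using hn, hx⟩
  · intro j _
    rw [stepMark, Equiv.Perm.iterate_eq_pow]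

theorem exists_bezout {d a b : ℕ} (h : Nat.gcd (Nat.gcd a b) d = 1) :
    ∃ u v : ZMod d, u * a + v * b = 1 := by
  have h1 := Nat.gcd_eq_gcd_ab (Nat.gcd a b) d
  have h2 := Nat.gcd_eq_gcd_ab a b
  rw [h, h2] at h1
  have h3 := congrArg (Int.cast : ℤ → ZMod d) h1
  push_cast at h3
  rw [ZMod.natCast_self] at h3
  refine ⟨Nat.gcdA a b * Nat.gcdA (Nat.gcd a b) d, Nat.gcdB a b * Nat.gcdA (Nat.gcd a b) d, ?_⟩
  rw [h3]
  ring

/-- After one full turn the coordinate is back at its start, so the total displacement vanishes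
modulo d. -/
theorem IsThreeStep.dvd_displacement {d a b : ℕ} {σ C : Equiv.Perm (Fin d)}
    (h : IsThreeStep a b σ) (ha : 0 < a) (hab : a < b) (hb : b < d)
    (hC : C ∈ σ.cycleFactorsFinset) :
    d ∣ a * (stepSet a C).card + b * (stepSet b C).card := by
  obtain ⟨i, hi⟩ := (Equiv.Perm.mem_cycleFactorsFinset_iff.1 hC).1.nonempty_support
  have hiσ : i ∈ (σ.support : Set (Fin d)) := Equiv.Perm.mem_cycleFactorsFinset_support_le hC hi
  have h1 := h.twoStep.coord_pow hiσ C.support.card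
  rw [(Equiv.Perm.isCycleOn_support_of_mem_cycleFactorsFinset hC).pow_card_apply hi,
    markCount_cycle ha (hab.trans hb) hC hi, (h.cycle ha hab hb hC).card_support hab hb,
    add_assoc, left_eq_add, nsmul_eq_mul, zsmul_eq_mul] at h1
  rw [← ZMod.natCast_eq_zero_iff, ← h1]
  push_cast
  ring

/-- The class of a cycle in the lattice of closed paths is primitive. -/
theorem IsThreeStep.gcd_eq_one {d a b : ℕ} {σ C : Equiv.Perm (Fin d)}
    (h : IsThreeStep a b σ) (ha : 0 < a) (hab : a < b) (hb : b < d)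
    (hC : C ∈ σ.cycleFactorsFinset) {w : ℕ}
    (hw : a * (stepSet a C).card + b * (stepSet b C).card = d * w) :
    Nat.gcd (Nat.gcd (stepSet a C).card (stepSet b C).card) w = 1 := by
  obtain ⟨i, hi⟩ := (Equiv.Perm.mem_cycleFactorsFinset_iff.1 hC).1.nonempty_support
  have hiσ : i ∈ (σ.support : Set (Fin d)) := Equiv.Perm.mem_cycleFactorsFinset_support_le hC hi
  have hcard := (h.cycle ha hab hb hC).card_support hab hb
  have hmark := markCount_cycle ha (hab.trans hb) hC hi
  have hpos : 0 < C.support.card := Finset.card_pos.2 ⟨i, hi⟩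
  have hcyc := Equiv.Perm.isCycleOn_support_of_mem_cycleFactorsFinset hC
  set r := Nat.gcd (Nat.gcd (stepSet a C).card (stepSet b C).card) w with hr
  obtain ⟨p, hp⟩ : r ∣ (stepSet a C).card := (Nat.gcd_dvd_left _ _).trans (Nat.gcd_dvd_left _ _)
  obtain ⟨q, hq⟩ : r ∣ (stepSet b C).card := (Nat.gcd_dvd_left _ _).trans (Nat.gcd_dvd_right _ _)
  obtain ⟨w', hw'⟩ : r ∣ w := Nat.gcd_dvd_right _ _
  rw [hp, hq, ← mul_add] at hcard
  have hr0 : 0 < r := Nat.pos_of_ne_zero fun h0 => by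
    rw [hcard, h0, zero_mul] at hpos
    exact hpos.false
  have hrel : a * p + b * q = d * w' := by
    apply Nat.eq_of_mul_eq_mul_left hr0
    calc r * (a * p + b * q) = a * (r * p) + b * (r * q) := by ring
      _ = d * w := by rw [← hp, ← hq, hw]
      _ = d * (r * w') := congrArg _ hw'
      _ = r * (d * w') := by ring
  -- One turn consists of r blocks of p + q steps, and (p + q) b + p (a - b) = pa + qb vanishes
  -- modulo d. So a single block closes up, the cycle length r(p + q) divides p + q, and r = 1.
  have hself := h.twoStep.pow_apply_eq_self hiσ (r := r) (n := p + q) (p := p) hr0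
    (by
      have := congrArg (Nat.cast : ℕ → ZMod d) hrel
      push_cast at this
      rw [ZMod.natCast_self] at this
      rw [nsmul_eq_mul, zsmul_eq_mul]
      push_cast
      linear_combination this)
    (by rw [← hcard, hmark, hp]; push_cast; ring)
  have hdvd := (hcyc.pow_apply_eq hi).1 hself
  rw [hcard] at hdvd hpos
  have hn : 0 < p + q := Nat.pos_of_mul_pos_left hpos
  have hle := Nat.le_of_dvd hn hdvd
  nlinarith

/-- All cycles have the same class. -/
theorem IsThreeStep.cycles_eq {d a b : ℕ} {σ C C' : Equiv.Perm (Fin d)}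
    (h : IsThreeStep a b σ) (ha : 0 < a) (hab : a < b) (hb : b < d)
    (hgcd : Nat.gcd (Nat.gcd a b) d = 1)
    (hC : C ∈ σ.cycleFactorsFinset) (hC' : C' ∈ σ.cycleFactorsFinset) :
    (stepSet a C).card = (stepSet a C').card ∧ (stepSet b C).card = (stepSet b C').card := by
  have hd : 0 < d := by omega
  have : NeZero d := ⟨hd.ne'⟩
  obtain ⟨i₀, hi₀⟩ := (Equiv.Perm.mem_cycleFactorsFinset_iff.1 hC).1.nonempty_support
  obtain ⟨i', hi'⟩ := (Equiv.Perm.mem_cycleFactorsFinset_iff.1 hC').1.nonempty_support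
  have hcyc := Equiv.Perm.isCycleOn_support_of_mem_cycleFactorsFinset hC
  have hcyc' := Equiv.Perm.isCycleOn_support_of_mem_cycleFactorsFinset hC'
  have hi₀σ : i₀ ∈ (σ.support : Set (Fin d)) :=
    Equiv.Perm.mem_cycleFactorsFinset_support_le hC hi₀
  have hi'σ : i' ∈ (σ.support : Set (Fin d)) :=
    Equiv.Perm.mem_cycleFactorsFinset_support_le hC' hi'
  obtain ⟨u, v, huv⟩ := exists_bezout hgcd
  obtain ⟨i, hi, t, hc⟩ : ∃ i ∈ C.support, ∃ t : ℤ,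
      coord i' = coord i + t • ((a : ZMod d) - b) := by
    -- By Bézout δ = δu·a + δv·b = δu(a - b) + (δu + δv)b. Walking δu + δv steps along the first
    -- cycle uses up the b-part, leaving a multiple of a - b.
    set δ := coord i' - coord i₀ with hδ
    set N := (δ * u + δ * v).val with hN
    refine ⟨(σ ^ N) i₀, hcyc.1.mapsTo.perm_pow N hi₀,
      ((δ * u).val : ℤ) - markCount σ (stepMark a σ) N i₀, ?_⟩
    rw [h.twoStep.coord_pow hi₀σ, nsmul_eq_mul, zsmul_eq_mul, zsmul_eq_mul]
    push_cast
    rw [hN, ZMod.natCast_zmod_val, ZMod.natCast_zmod_val]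
    linear_combination -hδ - δ * huv
  have hiσ : i ∈ (σ.support : Set (Fin d)) := Equiv.Perm.mem_cycleFactorsFinset_support_le hC hi
  have hs := h.twoStep.slope_eq hiσ hi'σ (hcyc.pow_card_apply hi) (hcyc'.pow_card_apply hi') hd
    (by rw [nsmul_eq_mul, ZMod.natCast_self, zero_mul]) hc
  rw [markCount_cycle ha (hab.trans hb) hC hi, markCount_cycle ha (hab.trans hb) hC' hi'] at hs
  have hcard := (h.cycle ha hab hb hC).card_support hab hb
  have hcard' := (h.cycle ha hab hb hC').card_support hab hb
  obtain ⟨w, hw⟩ := h.dvd_displacement ha hab hb hC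
  obtain ⟨w', hw'⟩ := h.dvd_displacement ha hab hb hC'
  have hg := h.gcd_eq_one ha hab hb hC hw
  have hg' := h.gcd_eq_one ha hab hb hC' hw'
  have hpos : 0 < C.support.card := Finset.card_pos.2 ⟨i, hi⟩
  set L := C.support.card
  set L' := C'.support.card
  set p := (stepSet a C).card
  set p' := (stepSet a C').card
  set q := (stepSet b C).card
  set q' := (stepSet b C').card
  have e1 : L' * p = L * p' := by exact_mod_cast hs
  have e2 : L' * q = L * q' := by
    rw [hcard, hcard'] at e1 ⊢
    nlinarith
  have e3 : L' * w = L * w' := by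
    apply Nat.eq_of_mul_eq_mul_left hd
    calc d * (L' * w) = L' * (d * w) := by ring
      _ = a * (L' * p) + b * (L' * q) := by rw [← hw]; ring
      _ = L * (d * w') := by rw [e1, e2, ← hw']; ring
      _ = d * (L * w') := by ring
  -- The two classes are proportional with ratio L : L', and both are primitive; comparing gcds
  -- gives equal lengths.
  have hLL : L' = L := by
    calc L' = L' * Nat.gcd (Nat.gcd p q) w := by rw [hg, mul_one]
      _ = L * Nat.gcd (Nat.gcd p' q') w' := by
        rw [← Nat.gcd_mul_left, ← Nat.gcd_mul_left, e1, e2, e3, Nat.gcd_mul_left, Nat.gcd_mul_left]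
      _ = L := by rw [hg', mul_one]
  rw [hLL] at e1 e2
  exact ⟨Nat.eq_of_mul_eq_mul_left hpos e1, Nat.eq_of_mul_eq_mul_left hpos e2⟩

end Cycles

/-! ### Cycle structure and sign of the contributing permutations. -/

section Classification

theorem cyclePerms_of_isThreeStep {d a b : ℕ} (ha : 0 < a) (hab : a < b) (hb : b < d)
    (hgcd : Nat.gcd (Nat.gcd a b) d = 1) {σ : Equiv.Perm (Fin d)} (h : IsThreeStep a b σ)
    {A B k : ℕ} (hA : (stepSet a σ).card = A) (hB : (stepSet b σ).card = B)
    (hk : k = Nat.gcd (Nat.gcd A B) ((a * A + b * B) / d)) :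
    d ∣ a * A + b * B ∧ σ ∈ cyclePerms d a b k ((A + B) / k) (A / k) (B / k) := by
  have hd : 0 < d := by omega
  rw [card_stepSet_eq_sum ha (hab.trans hb)] at hA
  rw [card_stepSet_eq_sum (ha.trans hab) hb] at hB
  rcases σ.cycleFactorsFinset.eq_empty_or_nonempty with hemp | ⟨C, hC⟩
  -- The identity: A = B = 0 and k = gcd(0, 0, 0) = 0.
  · rw [hemp, Finset.sum_empty] at hA hB
    subst hA hB
    simp [hk, cyclePerms, hemp]
  · have heq := fun C' hC' => h.cycles_eq (C := C') ha hab hb hgcd hC' hC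
    rw [Finset.sum_congr rfl fun C' hC' => (heq C' hC').1, Finset.sum_const, smul_eq_mul] at hA
    rw [Finset.sum_congr rfl fun C' hC' => (heq C' hC').2, Finset.sum_const, smul_eq_mul] at hB
    obtain ⟨w, hw⟩ := h.dvd_displacement ha hab hb hC
    have hg := h.gcd_eq_one ha hab hb hC hw
    have hn : 0 < σ.cycleFactorsFinset.card := Finset.card_pos.2 ⟨C, hC⟩
    have htot : a * A + b * B = d * (σ.cycleFactorsFinset.card * w) := by
      rw [← hA, ← hB, mul_left_comm d, ← hw]
      ring
    rw [htot, Nat.mul_div_cancel_left _ hd, ← hA, ← hB, Nat.gcd_mul_left, Nat.gcd_mul_left, hg,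
      mul_one] at hk
    refine ⟨⟨_, htot⟩, hk.symm, fun C' hC' => ?_⟩
    rw [← hA, ← hB, ← mul_add, hk, Nat.mul_div_cancel_left _ hn, Nat.mul_div_cancel_left _ hn,
      Nat.mul_div_cancel_left _ hn]
    exact ⟨by rw [(h.cycle ha hab hb hC').card_support hab hb, (heq C' hC').1, (heq C' hC').2],
      heq C' hC'⟩

/-- Each cycle has length A/k + B/k, so its a-steps and b-steps, being disjoint, already exhaust its
support. -/
theorem isThreeStep_of_cyclePerms {d a b : ℕ} (ha : 0 < a) (hab : a < b) (hb : b < d)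
    {σ : Equiv.Perm (Fin d)} {A B k : ℕ} (hkA : k ∣ A) (hkB : k ∣ B)
    (hσ : σ ∈ cyclePerms d a b k ((A + B) / k) (A / k) (B / k)) :
    IsThreeStep a b σ ∧ (stepSet a σ).card = A ∧ (stepSet b σ).card = B := by
  obtain ⟨hk, hC⟩ := hσ
  refine ⟨IsThreeStep.of_cycles ha hab hb fun C h => ?_, ?_, ?_⟩
  · obtain ⟨h1, h2, h3⟩ := hC C h
    refine (Finset.eq_of_subset_of_card_le (Finset.union_subset
      (stepSet_subset_support ha (hab.trans hb) C)
      (stepSet_subset_support (ha.trans hab) hb C)) ?_).symm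
    rw [Finset.card_union_of_disjoint (disjoint_stepSet hab hb C), h1, h2, h3,
      Nat.add_div_of_dvd_right hkA]
  · rw [card_stepSet_eq_sum ha (hab.trans hb), Finset.sum_congr rfl fun C h => (hC C h).2.1,
      Finset.sum_const, smul_eq_mul, hk, Nat.mul_div_cancel' hkA]
  · rw [card_stepSet_eq_sum (ha.trans hab) hb, Finset.sum_congr rfl fun C h => (hC C h).2.2,
      Finset.sum_const, smul_eq_mul, hk, Nat.mul_div_cancel' hkB]

theorem sign_eq_neg_one_pow_card {α : Type*} [Fintype α] [DecidableEq α] (σ : Equiv.Perm α) :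
    Equiv.Perm.sign σ = (-1) ^ (σ.support.card + σ.cycleFactorsFinset.card) := by
  rw [Equiv.Perm.sign_of_cycleType, Equiv.Perm.sum_cycleType, Equiv.Perm.cycleType_def,
    Multiset.card_map]
  rfl

end Classification

/-! ### Construction of a permutation by interval exchange. -/

section Existence

theorem val_sub_natCast_of_le {d : ℕ} [NeZero d] (y : ZMod d) {A : ℕ} (h : A ≤ y.val) :
    (y - A).val = y.val - A := by
  have : y - A = ((y.val - A : ℕ) : ZMod d) := by
    rw [Nat.cast_sub h, ZMod.natCast_zmod_val]
  rw [this]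
  exact ZMod.val_cast_of_lt ((Nat.sub_le _ _).trans_lt y.val_lt)

theorem val_sub_natCast_of_lt {d : ℕ} [NeZero d] (y : ZMod d) {A : ℕ} (hA : A ≤ d)
    (h : y.val < A) : (y - A).val = y.val + d - A := by
  have : y - A = ((y.val + d - A : ℕ) : ZMod d) := by
    rw [Nat.cast_sub (by omega), Nat.cast_add, ZMod.natCast_zmod_val, ZMod.natCast_self, add_zero]
  rw [this]
  exact ZMod.val_cast_of_lt (by omega)

theorem val_add_natCast_of_lt {d : ℕ} [NeZero d] (y : ZMod d) {B : ℕ} (h : y.val + B < d) :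
    (y + B).val = y.val + B := by
  have : y + B = ((y.val + B : ℕ) : ZMod d) := by
    rw [Nat.cast_add, ZMod.natCast_zmod_val]
  rw [this]
  exact ZMod.val_cast_of_lt h

/-- A multiplication on `ZMod d` sends exactly `A` points into `{0, …, A - 1}`, if `A` is a
multiple of the multiplier. -/
theorem card_val_mul_lt {d : ℕ} [NeZero d] (m s : ZMod d) {A : ℕ} (hA : A ≤ d)
    (hs : m * s = -A) : (Finset.univ.filter fun x : ZMod d => (m * x).val < A).card = A := by
  have hpt : ∀ x : ZMod d, ((m * (x + s)).val : ℤ) =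
      (m * x).val - A + d * (if (m * x).val < A then 1 else 0) := by
    intro x
    rw [mul_add, hs, ← sub_eq_add_neg]
    split_ifs with h
    · rw [val_sub_natCast_of_lt _ hA h]
      push_cast [show A ≤ (m * x).val + d by omega]
      ring
    · rw [val_sub_natCast_of_le _ (not_lt.1 h)]
      push_cast [not_lt.1 h]
      ring
  -- Translation by `s` preserves the sum of representatives, while pointwise it subtracts A and
  -- adds d exactly where wrapping occurs. Hence d times the number of wraps is dA.
  have hsum : ∑ x : ZMod d, ((m * (x + s)).val : ℤ) = ∑ x : ZMod d, ((m * x).val : ℤ) :=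
    Equiv.sum_comp (Equiv.addRight s) fun x => ((m * x).val : ℤ)
  rw [Finset.sum_congr rfl fun x _ => hpt x, Finset.sum_add_distrib, Finset.sum_sub_distrib,
    ← Finset.mul_sum, Finset.sum_const, Finset.card_univ, ZMod.card, ← Finset.natCast_card_filter,
    nsmul_eq_mul] at hsum
  have hd : (d : ℤ) ≠ 0 := by exact_mod_cast NeZero.ne d
  have : (d : ℤ) * (Finset.univ.filter fun x : ZMod d => (m * x).val < A).card = d * A := by
    linarith
  exact_mod_cast mul_left_cancel₀ hd this

/-- Interchange of the preimages, under multiplication by `m`, of two adjacent intervals of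
lengths `A` and `B`. -/
def intervalSwap {d : ℕ} (a b A B : ℕ) (m x : ZMod d) : ZMod d :=
  if (m * x).val < A then x + a else if (m * x).val < A + B then x + b else x

/-- On representatives of m x the map exchanges [0, A) and [A, A + B), by shifts +B and -A. The
value at the image thus determines the branch, and each branch is a translation of x; `m` need not
be a unit. -/
theorem intervalSwap_injective {d : ℕ} [NeZero d] {a b A B : ℕ} (hAB : A + B ≤ d) {m : ZMod d}
    (hma : m * a = B) (hmb : m * b = -A) : Function.Injective (intervalSwap a b A B m) := by
  have hval : ∀ x, (m * intervalSwap a b A B m x).val =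
      if (m * x).val < A then (m * x).val + B
      else if (m * x).val < A + B then (m * x).val - A else (m * x).val := by
    intro x
    unfold intervalSwap
    split_ifs with h1 h2
    · rw [mul_add, hma, val_add_natCast_of_lt _ (by omega)]
    · rw [mul_add, hmb, ← sub_eq_add_neg, val_sub_natCast_of_le _ (by omega)]
    · rfl
  intro x y hxy
  have h := hval x
  rw [hxy, hval y] at h
  unfold intervalSwap at hxy
  split_ifs at hxy h <;> first | omega | exact add_right_cancel hxy

theorem exists_isThreeStep {d a b A B : ℕ} (ha : 0 < a) (hab : a < b) (hb : b < d)
    (hgcd : Nat.gcd (Nat.gcd a b) d = 1) (hAB : A + B ≤ d) (hdvd : d ∣ a * A + b * B) :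
    ∃ σ : Equiv.Perm (Fin d), IsThreeStep a b σ ∧ (stepSet a σ).card = A ∧
      (stepSet b σ).card = B := by
  have : NeZero d := ⟨by omega⟩
  obtain ⟨u, v, huv⟩ := exists_bezout hgcd
  have hz : (a : ZMod d) * A + b * B = 0 := by
    have := (ZMod.natCast_eq_zero_iff _ _).2 hdvd
    push_cast at this
    exact this
  -- For m = uB - vA, Bézout gives ma = B - v(aA + bB) and mb = -A + u(aA + bB), where the brackets
  -- vanish modulo d.
  obtain ⟨m, hma, hmb⟩ : ∃ m : ZMod d, m * a = B ∧ m * b = -A :=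
    ⟨u * B - v * A, by linear_combination B * huv - v * hz, by
      linear_combination -A * huv + u * hz⟩
  let e : Fin d ≃ ZMod d := Equiv.ofBijective coord
    ((Fintype.bijective_iff_injective_and_card _).2 ⟨coord_injective, by simp [ZMod.card]⟩)
  let F : Equiv.Perm (ZMod d) := Equiv.ofBijective _
    (Finite.injective_iff_bijective.1 (intervalSwap_injective hAB hma hmb))
  let σ : Equiv.Perm (Fin d) := e.symm.permCongr F
  have hσ : ∀ i, coord (σ i) = intervalSwap a b A B m (coord i) := fun i =>
    e.apply_symm_apply _
  have ha0 := natCast_ne_zero_of_lt ha (hab.trans hb)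
  have hb0 := natCast_ne_zero_of_lt (ha.trans hab) hb
  have hne : (a : ZMod d) ≠ b := fun h =>
    hab.ne (Nat.ModEq.eq_of_lt_of_lt ((ZMod.natCast_eq_natCast_iff _ _ _).1 h) (hab.trans hb) hb)
  have hsa : ∀ i, i ∈ stepSet a σ ↔ (m * coord i).val < A := by
    intro i
    rw [mem_stepSet, hσ]
    unfold intervalSwap
    split_ifs with h1 h2
    · simp [h1]
    · simp [h1, hne.symm]
    · simp [h1, ha0]
  have hsb : ∀ i, i ∈ stepSet b σ ↔ (m * coord i).val < A + B ∧ ¬ (m * coord i).val < A := by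
    intro i
    rw [mem_stepSet, hσ]
    unfold intervalSwap
    split_ifs with h1 h2
    · simp [h1, hne]
    · simp [h1, h2]
    · simp [h2, hb0]
  have hcardA : (stepSet a σ).card = A := by
    rw [← card_val_mul_lt m b (by omega) hmb]
    exact Finset.card_equiv e fun i => by rw [hsa]; simp [e]
  have hcardAB : (stepSet a σ ∪ stepSet b σ).card = A + B := by
    rw [← card_val_mul_lt m ((b : ZMod d) - a) hAB (by push_cast; linear_combination hmb - hma)]
    refine Finset.card_equiv e fun i => ?_
    rw [Finset.mem_union, hsa, hsb]
    simp only [e, Equiv.ofBijective_apply, Finset.mem_filter, Finset.mem_univ, true_and]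
    omega
  refine ⟨σ, ?_, hcardA, ?_⟩
  · refine Finset.Subset.antisymm (fun i hi => ?_) (Finset.union_subset
      (stepSet_subset_support ha (hab.trans hb) σ) (stepSet_subset_support (ha.trans hab) hb σ))
    rw [Finset.mem_union, hsa, hsb]
    by_contra hcon
    rw [Equiv.Perm.mem_support] at hi
    apply hi
    apply coord_injective
    rw [hσ, intervalSwap, if_neg (by omega), if_neg (by omega)]
  · rw [Finset.card_union_of_disjoint (disjoint_stepSet hab hb σ), hcardA] at hcardAB
    omega

end Existence

/-! ### The determinant coefficient as a signed count. -/

section Determinant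

open MvPolynomial

theorem val_sub_eq_iff {d q : ℕ} (hq : q < d) (i j : Fin d) :
    ((j - i : Fin d) : ℕ) = q ↔ coord j = coord i + q := by
  have hsub : coord (j - i) = coord j - coord i := by
    unfold coord
    rw [Fin.val_sub, ZMod.natCast_mod, Nat.cast_add, Nat.cast_sub i.2.le, ZMod.natCast_self]
    ring
  rw [← sub_eq_iff_eq_add', ← hsub, coord, ZMod.natCast_eq_natCast_iff]
  exact ⟨fun h => by rw [h], fun h => Nat.ModEq.eq_of_lt_of_lt h (j - i).2 hq⟩

theorem circThree_apply {d a b : ℕ} (hab : a < b) (hb : b < d)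
    (σ : Equiv.Perm (Fin d)) (i : Fin d) :
    circThree d a b i (σ i) =
      if i ∉ σ.support then X 0 else if i ∈ stepSet a σ then X 1
      else if i ∈ stepSet b σ then X 2 else 0 := by
  have h0 : ((σ i - i : Fin d) : ℕ) = 0 ↔ i ∉ σ.support := by
    rw [val_sub_eq_iff (by omega), Nat.cast_zero, add_zero, Equiv.Perm.notMem_support]
    exact coord_injective.eq_iff
  simp only [circThree, circ, Matrix.of_apply, h0, val_sub_eq_iff (hab.trans hb),
    val_sub_eq_iff hb, mem_stepSet]

theorem IsThreeStep.prod_circThree {d a b : ℕ} {σ : Equiv.Perm (Fin d)} (h : IsThreeStep a b σ)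
    (hab : a < b) (hb : b < d) :
    ∏ i, circThree d a b i (σ i) = monomial (Finsupp.single 0 (d - (stepSet a σ).card -
      (stepSet b σ).card) + Finsupp.single 1 (stepSet a σ).card +
      Finsupp.single 2 (stepSet b σ).card) 1 := by
  have hdisj := disjoint_stepSet hab hb σ
  have hcompl : σ.supportᶜ.card = d - (stepSet a σ).card - (stepSet b σ).card := by
    rw [Finset.card_compl, h.card_support hab hb, Fintype.card_fin, Nat.sub_sub]
  have hsup := h
  unfold IsThreeStep at hsup
  have h0 : ∏ i ∈ σ.supportᶜ, circThree d a b i (σ i) = X 0 ^ σ.supportᶜ.card := by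
    refine Finset.prod_eq_pow_card fun i hi => ?_
    rw [circThree_apply hab hb, if_pos (Finset.mem_compl.1 hi)]
  have h1 : ∏ i ∈ stepSet a σ, circThree d a b i (σ i) = X 1 ^ (stepSet a σ).card := by
    refine Finset.prod_eq_pow_card fun i hi => ?_
    rw [circThree_apply hab hb, if_neg (by rw [hsup]; simp [hi]), if_pos hi]
  have h2 : ∏ i ∈ stepSet b σ, circThree d a b i (σ i) = X 2 ^ (stepSet b σ).card := by
    refine Finset.prod_eq_pow_card fun i hi => ?_
    rw [circThree_apply hab hb, if_neg (by rw [hsup]; simp [hi]),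
      if_neg (Finset.disjoint_right.1 hdisj hi), if_pos hi]
  rw [← Finset.prod_compl_mul_prod σ.support, h0, hsup, Finset.prod_union hdisj, h1, h2, ← hsup,
    hcompl, X_pow_eq_monomial, X_pow_eq_monomial, X_pow_eq_monomial, monomial_mul, monomial_mul,
    one_mul, one_mul, add_assoc]

theorem prod_circThree_eq_zero {d a b : ℕ} {σ : Equiv.Perm (Fin d)} (h : ¬ IsThreeStep a b σ)
    (ha : 0 < a) (hab : a < b) (hb : b < d) : ∏ i, circThree d a b i (σ i) = 0 := by
  obtain ⟨i, hi, hi'⟩ : ∃ i ∈ σ.support, i ∉ stepSet a σ ∪ stepSet b σ := by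
    by_contra! hcon
    exact h (Finset.Subset.antisymm hcon (Finset.union_subset
      (stepSet_subset_support ha (hab.trans hb) σ) (stepSet_subset_support (ha.trans hab) hb σ)))
  rw [Finset.mem_union, not_or] at hi'
  refine Finset.prod_eq_zero (Finset.mem_univ i) ?_
  rw [circThree_apply hab hb, if_neg (not_not.2 hi), if_neg hi'.1, if_neg hi'.2]

open Classical in
theorem detCoeff_eq_sum {d a b A B : ℕ} (ha : 0 < a) (hab : a < b) (hb : b < d) :
    detCoeff d a b A B = ∑ σ ∈ Finset.univ.filter fun σ : Equiv.Perm (Fin d) =>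
      IsThreeStep a b σ ∧ (stepSet a σ).card = A ∧ (stepSet b σ).card = B,
      ((Equiv.Perm.sign σ : ℤˣ) : ℤ) := by
  -- The Leibniz formula uses entries (σ i, i); transposing gives entries (i, σ i), which record the
  -- step σ i - i.
  rw [detCoeff, ← Matrix.det_transpose, Matrix.det_apply, coeff_sum, Finset.sum_filter]
  refine Finset.sum_congr rfl fun σ _ => ?_
  simp only [Matrix.transpose_apply, Units.smul_def]
  rw [coeff_smul]
  by_cases h : IsThreeStep a b σ
  · rw [h.prod_circThree hab hb, coeff_monomial]
    simp only [h, true_and]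
    by_cases hc : (stepSet a σ).card = A ∧ (stepSet b σ).card = B
    · rw [if_pos hc, hc.1, hc.2, if_pos rfl, smul_eq_mul, mul_one]
    · rw [if_neg hc, if_neg, smul_zero]
      intro heq
      refine hc ⟨?_, ?_⟩
      · simpa using DFunLike.congr_fun heq 1
      · simpa using DFunLike.congr_fun heq 2
  · rw [prod_circThree_eq_zero h ha hab hb, coeff_zero, smul_zero, if_neg fun hc => h hc.1]

end Determinant

/-! ### Assembly of the three claims. -/

theorem theorem2p3 (d a b : ℕ) (hd : 3 ≤ d) (ha : 1 ≤ a) (hab : a < b) (hb : b ≤ d - 1)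
    (hgcd : Nat.gcd (Nat.gcd a b) d = 1) (A B : ℕ) (hAB : A + B ≤ d) :
    (detCoeff d a b A B ≠ 0 ↔ d ∣ a * A + b * B) ∧
    (d ∣ a * A + b * B →
      ∀ k : ℕ, k = Nat.gcd (Nat.gcd A B) ((a * A + b * B) / d) →
        (0 < detCoeff d a b A B ↔ Even k ∨ Even ((A : ℤ) + (B : ℤ) - 1)) ∧
        (detCoeff d a b A B).natAbs =
          (cyclePerms d a b k ((A + B) / k) (A / k) (B / k)).ncard) := by
  classical
  have hbd : b < d := by omega
  set k := Nat.gcd (Nat.gcd A B) ((a * A + b * B) / d) with hk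
  have hkA : k ∣ A := (Nat.gcd_dvd_left _ _).trans (Nat.gcd_dvd_left _ _)
  have hkB : k ∣ B := (Nat.gcd_dvd_left _ _).trans (Nat.gcd_dvd_right _ _)
  set S := Finset.univ.filter fun σ : Equiv.Perm (Fin d) =>
      IsThreeStep a b σ ∧ (stepSet a σ).card = A ∧ (stepSet b σ).card = B with hS
  have hclass : ∀ σ ∈ S, d ∣ a * A + b * B ∧
      σ ∈ cyclePerms d a b k ((A + B) / k) (A / k) (B / k) := by
    intro σ hσ
    obtain ⟨h, hA, hB⟩ := (Finset.mem_filter.1 hσ).2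
    exact cyclePerms_of_isThreeStep ha hab hbd hgcd h hA hB hk
  have hcoe : (S : Set (Equiv.Perm (Fin d))) =
      cyclePerms d a b k ((A + B) / k) (A / k) (B / k) := by
    ext σ
    refine ⟨fun hσ => (hclass σ hσ).2, fun hσ => ?_⟩
    simpa [hS] using isThreeStep_of_cyclePerms ha hab hbd hkA hkB hσ
  -- All terms share one sign: the support has A + B points and there are k cycles.
  have hdet : detCoeff d a b A B = S.card * (-1) ^ (A + B + k) := by
    rw [detCoeff_eq_sum ha hab hbd, ← hS, Finset.cast_card, Finset.sum_mul]
    refine Finset.sum_congr rfl fun σ hσ => ?_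
    obtain ⟨h, hA, hB⟩ := (Finset.mem_filter.1 hσ).2
    rw [sign_eq_neg_one_pow_card, h.card_support hab hbd, hA, hB, (hclass σ hσ).2.1]
    simp
  have hpos : d ∣ a * A + b * B → 0 < S.card := fun hdvd => by
    obtain ⟨σ, hσ⟩ := exists_isThreeStep ha hab hbd hgcd hAB hdvd
    exact Finset.card_pos.2 ⟨σ, Finset.mem_filter.2 ⟨Finset.mem_univ _, hσ⟩⟩
  refine ⟨⟨fun hne => ?_, fun hdvd => ?_⟩, fun hdvd k' hk' => ?_⟩
  · rcases S.eq_empty_or_nonempty with h0 | ⟨σ, hσ⟩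
    · rw [hdet, h0] at hne
      simp at hne
    · exact (hclass σ hσ).1
  · rw [hdet]
    have := hpos hdvd
    exact mul_ne_zero (by exact_mod_cast this.ne') (pow_ne_zero _ (by norm_num))
  · subst hk'
    have hS0 : (0 : ℤ) < S.card := by exact_mod_cast hpos hdvd
    refine ⟨?_, ?_⟩
    -- Since k divides A + B, an even k forces A + B even; for odd k the exponent is even exactly
    -- when A + B is odd.
    · have hiff : (Even k ∨ Even ((A : ℤ) + (B : ℤ) - 1)) ↔ Even (A + B + k) := by
        have hdvd2 : Even k → Even (A + B) := fun h =>
          even_iff_two_dvd.2 ((even_iff_two_dvd.1 h).trans (dvd_add hkA hkB))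
        rw [Int.even_sub_one, ← Nat.cast_add, Int.even_coe_nat, Nat.even_add (m := A + B)]
        tauto
      rw [hiff, hdet, mul_pos_iff_of_pos_left hS0]
      rcases Nat.even_or_odd (A + B + k) with h | h
      · simp [h]
      · simp [h, Nat.not_even_iff_odd.2 h]
    · rw [hdet, ← hcoe, Set.ncard_coe_finset, Int.natAbs_mul, Int.natAbs_pow]
      simp
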